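/- A co-Heyting algebra is a bounded distributive lattice $L$ in which $a-b=\min\{c : a\le b\vee c\}$ exists for all $a,b$; put $a\bigtriangleup b=(a-b)\vee(b-a)$. The foundation rank of an element $x$ of an ordered set is the ordinal rank defined inductively by: $\mathrm{rk}\,x\ge\alpha$ iff for every $\beta<\alpha$ there is $y<x$ with $\mathrm{rk}\,y\ge\beta$ ($\mathrm{rk}\,x=+\infty$ if this holds for all ordinals $\alpha$); the cofoundation rank is the foundation rank for the reverse order. The codimension $\operatorname{codim} a$ of $a\in L$ is the minimum of the foundation ranks, in the set of prime filters of $L$ ordered by inclusion, of the prime filters containing $a$ ($+\infty$ if there is none). For $d\in\mathbb N$ let $dL$ be the ideal $\{a\in L : \operatorname{codim} a\ge d\}$, let $L/dL$ be the quotient co-Heyting algebra of $L$ by the congruence $a\bigtriangleup b\in dL$, and let $\widehat L$ be the projective limit of the quotients $L/dL$ along the projections $L/(d+1)L\to L/dL$. Equip $L$ with the pseudometric $2^{-\operatorname{codim}(a\bigtriangleup b)}$ (read as $0$ when this codimension is not finite). $L$ is called Hausdorff if the topology of this pseudometric is Hausdorff, and precompact if $L/dL$ is finite for every $d\in\mathbb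 N$. An element $x$ of a bounded lattice is completely join irreducible if $x\ne\mathbf 0$ and, for every subset $A$ that has a join with $x\le\bigvee A$, there is $a\in A$ with $x\le a$; it is completely meet irreducible if $x\ne\mathbf 1$ and, for every subset $A$ that has a meet with $\bigwedge A\le x$, there is $a\in A$ with $a\le x$. Let $\mathcal I^{!\vee}(L)$ and $\mathcal I^{!\wedge}(L)$ be the sets of these elements. **Proposition.** Let $L$ be a precompact Hausdorff co-Heyting algebra. Then: 1. The canonical morphism $L\to\widehat L$ is injective and, identifying $L$ with its image, $\mathcal I^{!\wedge}(L)=\mathcal I^{!\wedge}(\widehat L)$. 2. For every $x\in\mathcal I^{!\vee}(L)$ the join $x^\wedge=\bigvee\{y\in L : x\not\le y\}$ exists in $L$, for every $x\in\mathcal I^{!\wedge}(L)$ the meet $x^\vee=\bigwedge\{y\in L : y\not\le x\}$ exists in $L$, and $x\mapsto x^\wedge$, $x\mapsto x^\vee$ are mutually inverse order-preserving bijections between $\mathcal I^{!\vee}(L)$ and $\mathcal I^{!\wedge}(L)$. 3. For every $x\in\mathcal I^{!\wedge}(L)$ the cofoundation rank of $x$ in the ordered set $\mathcal I^{!\wedge}(L)$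 is finite. 4. $\mathcal I^{!\wedge}(L)$ satisfies the ascending chain condition. 5. Every $a\in L$ is the meet in $L$ of the set $\{x\in\mathcal I^{!\wedge}(L) : a\le x\}$. -/

import Mathlib

universe u

namespace CoHeyting

/-! ### Foundation rank and cofoundation rank -/

section Rank

variable {E : Type u} [Preorder E]

open Classical in
/-- The foundation rank of `x` in the ordered set `E`: the ordinal rank of `x` for `<` when `x`
lies in the well-founded part of `E`, and `⊤` (that is, `+∞`) otherwise. -/
noncomputable def foundationRank (x : E) : WithTop Ordinal.{u} :=
  if h : Acc (fun a b : E => a < b) x then ((h.rank : Ordinal.{u}) : WithTop Ordinal.{u}) else ⊤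

/-- The cofoundation rank of `x`: its foundation rank for the reverse order. -/
noncomputable def cofoundationRank (x : E) : WithTop Ordinal.{u} :=
  foundationRank (OrderDual.toDual x)

/-- The recursive characterization of the foundation rank (zero, successor and limit clauses
in one): `rk x ≥ α` iff for all `β < α` there is `y < x` with `rk y ≥ β`. -/
theorem le_foundationRank_iff (α : Ordinal.{u}) (x : E) :
    (α : WithTop Ordinal.{u}) ≤ foundationRank x ↔
      ∀ β < α, ∃ y < x, (β : WithTop Ordinal.{u}) ≤ foundationRank y := by
  by_cases h : Acc (fun a b : E => a < b) x
  · have key : ∀ y (hy : Acc (fun a b : E => a < b) y),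
        foundationRank y = ((hy.rank : Ordinal.{u}) : WithTop Ordinal.{u}) := by
      intro y hy
      simp [foundationRank, hy]
    rw [key x h]
    constructor
    · intro hα β hβ
      have hα' : β < h.rank := lt_of_lt_of_le hβ (WithTop.coe_le_coe.1 hα)
      rw [Acc.rank_eq, Ordinal.lt_iSup_iff] at hα'
      obtain ⟨⟨y, hy⟩, hlt⟩ := hα'
      refine ⟨y, hy, ?_⟩
      rw [key y (h.inv hy)]
      exact WithTop.coe_le_coe.2 (Order.lt_succ_iff.1 hlt)
    · intro H
      refine WithTop.coe_le_coe.2 (le_of_forall_lt fun β hβ => ?_)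
      obtain ⟨y, hy, hle⟩ := H β hβ
      rw [key y (h.inv hy)] at hle
      exact lt_of_le_of_lt (WithTop.coe_le_coe.1 hle) (Acc.rank_lt_of_rel h hy)
  · have hx : foundationRank x = ⊤ := by simp [foundationRank, h]
    have hy : ∃ y < x, ¬ Acc (fun a b : E => a < b) y := by
      by_contra hcon
      push Not at hcon
      exact h (Acc.intro x hcon)
    obtain ⟨y, hyx, hy⟩ := hy
    simp only [hx, le_top, true_iff]
    intro β _
    exact ⟨y, hyx, by simp [foundationRank, hy]⟩

end Rank

/-! ### Prime filters and codimension -/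

section Codim

variable {L : Type u} [Lattice L]

/-- The prime filter spectrum of a lattice, ordered by inclusion. -/
abbrev Spec (L : Type u) [Lattice L] : Type u :=
  {p : Order.PFilter L // p.IsPrime}

/-- The height of a prime filter: its foundation rank in the spectrum. -/
noncomputable def height (p : Spec L) : WithTop Ordinal.{u} :=
  foundationRank p

/-- The codimension of `a`: the minimum of the heights of the prime filters containing `a`
(and `+∞` if there are none). -/
noncomputable def codim (a : L) : WithTop Ordinal.{u} :=
  ⨅ p : Spec L, ⨅ _ : a ∈ p.1, height p

theorem codim_anti {a b : L} (h : a ≤ b) : codim b ≤ codim a := by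
  unfold codim
  refine le_iInf₂ fun p hp => ?_
  exact iInf₂_le (f := fun (q : Spec L) (_ : b ∈ q.1) => height q) p
    (Order.PFilter.mem_of_le h hp)

theorem codim_le_height {a : L} (p : Spec L) (hp : a ∈ p.1) : codim a ≤ height p := by
  unfold codim
  exact iInf₂_le (f := fun (q : Spec L) (_ : a ∈ q.1) => height q) p hp

theorem le_codim {a : L} {α : WithTop Ordinal.{u}} (h : ∀ p : Spec L, a ∈ p.1 → α ≤ height p) :
    α ≤ codim a := by
  unfold codim
  exact le_iInf₂ h

theorem codim_sup (a b : L) : codim (a ⊔ b) = min (codim a) (codim b) := by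
  refine le_antisymm (le_min (codim_anti le_sup_left) (codim_anti le_sup_right)) ?_
  refine le_codim fun p hp => ?_
  by_cases ha : a ∈ p.1
  · exact (min_le_left _ _).trans (codim_le_height p ha)
  by_cases hb : b ∈ p.1
  · exact (min_le_right _ _).trans (codim_le_height p hb)
  exfalso
  obtain ⟨c, hc, hac, hbc⟩ := p.2.compl_ideal.Directed a ha b hb
  exact hc (Order.PFilter.mem_of_le (sup_le hac hbc) hp)

theorem codim_bot [OrderBot L] : codim (⊥ : L) = ⊤ := by
  refine top_le_iff.1 (le_codim fun p hp => ?_)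
  obtain ⟨c, hc⟩ := p.2.compl_ideal.Nonempty
  exact absurd (Order.PFilter.mem_of_le bot_le hp) hc

/-- The ideal `dL` of the elements of codimension at least `d`. -/
noncomputable def codimIdeal (L : Type u) [Lattice L] [OrderBot L] (d : ℕ) : Order.Ideal L where
  carrier := {a | ((d : Ordinal.{u}) : WithTop Ordinal.{u}) ≤ codim a}
  lower' := fun _ _ hba ha => le_trans ha (codim_anti hba)
  nonempty' := ⟨⊥, by simp [codim_bot]⟩
  directed' := fun a ha b hb =>
    ⟨a ⊔ b, by
      change _ ≤ codim (a ⊔ b)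
      rw [codim_sup]
      exact le_min ha hb, le_sup_left, le_sup_right⟩

theorem mem_codimIdeal [OrderBot L] {d : ℕ} {a : L} :
    a ∈ codimIdeal L d ↔ ((d : Ordinal.{u}) : WithTop Ordinal.{u}) ≤ codim a :=
  Iff.rfl

theorem codimIdeal_succ_le [OrderBot L] (d : ℕ) : codimIdeal L (d + 1) ≤ codimIdeal L d := by
  intro a ha
  refine le_trans (WithTop.coe_le_coe.2 ?_) (mem_codimIdeal.1 ha)
  exact_mod_cast Nat.le_succ d

end Codim

/-! ### Quotient of a co-Heyting algebra by an ideal -/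

section Quotient

variable {L : Type u} [CoheytingAlgebra L]

open scoped symmDiff

theorem symmDiff_mem_iff (I : Order.Ideal L) {a b : L} : a ∆ b ∈ I ↔ a \ b ∈ I ∧ b \ a ∈ I :=
  Order.Ideal.sup_mem_iff

theorem sdiff_mem_trans (I : Order.Ideal L) {a b c : L} (h₁ : a \ b ∈ I) (h₂ : b \ c ∈ I) :
    a \ c ∈ I :=
  I.lower (sdiff_triangle a b c) (Order.Ideal.sup_mem h₁ h₂)

/-- The congruence `a ≡ b ↔ a ∆ b ∈ I` attached to an ideal `I`. -/
def idealSetoid (I : Order.Ideal L) : Setoid L where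
  r a b := a ∆ b ∈ I
  iseqv :=
    { refl := fun a => by simp
      symm := fun {a b} h => by rwa [symmDiff_comm]
      trans := fun {a b c} h₁ h₂ =>
        I.lower (symmDiff_triangle a b c) (Order.Ideal.sup_mem h₁ h₂) }

/-- The quotient `L/I`. -/
def IdealQuotient (I : Order.Ideal L) : Type u :=
  _root_.Quotient (idealSetoid I)

namespace IdealQuotient

variable (I : Order.Ideal L)

/-- The canonical projection `L → L/I`. -/
def mk (a : L) : IdealQuotient I :=
  _root_.Quotient.mk (idealSetoid I) a

variable {I}

theorem mk_eq_iff {a b : L} : mk I a = mk I b ↔ a ∆ b ∈ I :=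
  ⟨fun h => _root_.Quotient.exact h, fun h => _root_.Quotient.sound (s := idealSetoid I) h⟩

theorem mk_surjective : Function.Surjective (mk I) := fun q =>
  _root_.Quotient.inductionOn q fun a => ⟨a, rfl⟩

theorem sup_congr {a₁ a₂ b₁ b₂ : L} (h₁ : a₁ \ b₁ ∈ I) (h₂ : a₂ \ b₂ ∈ I) :
    (a₁ ⊔ a₂) \ (b₁ ⊔ b₂) ∈ I := by
  refine I.lower ?_ (Order.Ideal.sup_mem h₁ h₂)
  rw [sup_sdiff]
  exact sup_le_sup (sdiff_le_sdiff_left le_sup_left) (sdiff_le_sdiff_left le_sup_right)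

theorem inf_congr {a₁ a₂ b₁ b₂ : L} (h₁ : a₁ \ b₁ ∈ I) (h₂ : a₂ \ b₂ ∈ I) :
    (a₁ ⊓ a₂) \ (b₁ ⊓ b₂) ∈ I := by
  refine I.lower ?_ (Order.Ideal.sup_mem h₁ h₂)
  rw [sdiff_inf]
  exact sup_le_sup (sdiff_le_sdiff_right inf_le_left) (sdiff_le_sdiff_right inf_le_right)

theorem sdiff_congr {a₁ a₂ b₁ b₂ : L} (h₁ : a₁ \ b₁ ∈ I) (h₂ : b₂ \ a₂ ∈ I) :
    (a₁ \ a₂) \ (b₁ \ b₂) ∈ I := by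
  refine I.lower ?_ (Order.Ideal.sup_mem h₁ h₂)
  rw [sdiff_le_iff, sdiff_le_iff]
  have e₁ : a₁ ≤ b₁ ⊔ a₁ \ b₁ := le_sup_sdiff
  have e₂ : b₁ ≤ b₂ ⊔ b₁ \ b₂ := le_sup_sdiff
  have e₃ : b₂ ≤ a₂ ⊔ b₂ \ a₂ := le_sup_sdiff
  calc a₁ ≤ b₁ ⊔ a₁ \ b₁ := e₁
    _ ≤ (b₂ ⊔ b₁ \ b₂) ⊔ a₁ \ b₁ := sup_le_sup_right e₂ _
    _ ≤ ((a₂ ⊔ b₂ \ a₂) ⊔ b₁ \ b₂) ⊔ a₁ \ b₁ := sup_le_sup_right (sup_le_sup_right e₃ _) _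
    _ = a₂ ⊔ (b₁ \ b₂ ⊔ (a₁ \ b₁ ⊔ b₂ \ a₂)) := by ac_rfl

/-- `mk a ≤ mk b` iff `a - b ∈ I`. -/
instance : LE (IdealQuotient I) where
  le := _root_.Quotient.lift₂ (fun a b => a \ b ∈ I) (by
    intro a₁ b₁ a₂ b₂ ha hb
    have ha' := (symmDiff_mem_iff I).1 ha
    have hb' := (symmDiff_mem_iff I).1 hb
    exact propext
      ⟨fun h => sdiff_mem_trans I ha'.2 (sdiff_mem_trans I h hb'.1),
        fun h => sdiff_mem_trans I ha'.1 (sdiff_mem_trans I h hb'.2)⟩)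

theorem mk_le_mk {a b : L} : mk I a ≤ mk I b ↔ a \ b ∈ I := Iff.rfl

instance : Max (IdealQuotient I) where
  max := _root_.Quotient.map₂ (· ⊔ ·) (by
    intro a₁ b₁ ha a₂ b₂ hb
    have ha' := (symmDiff_mem_iff I).1 ha
    have hb' := (symmDiff_mem_iff I).1 hb
    exact (symmDiff_mem_iff I).2 ⟨sup_congr ha'.1 hb'.1, sup_congr ha'.2 hb'.2⟩)

instance : Min (IdealQuotient I) where
  min := _root_.Quotient.map₂ (· ⊓ ·) (by
    intro a₁ b₁ ha a₂ b₂ hb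
    have ha' := (symmDiff_mem_iff I).1 ha
    have hb' := (symmDiff_mem_iff I).1 hb
    exact (symmDiff_mem_iff I).2 ⟨inf_congr ha'.1 hb'.1, inf_congr ha'.2 hb'.2⟩)

instance : SDiff (IdealQuotient I) where
  sdiff := _root_.Quotient.map₂ (· \ ·) (by
    intro a₁ b₁ ha a₂ b₂ hb
    have ha' := (symmDiff_mem_iff I).1 ha
    have hb' := (symmDiff_mem_iff I).1 hb
    exact (symmDiff_mem_iff I).2 ⟨sdiff_congr ha'.1 hb'.2, sdiff_congr ha'.2 hb'.1⟩)

instance : Top (IdealQuotient I) := ⟨mk I ⊤⟩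
instance : Bot (IdealQuotient I) := ⟨mk I ⊥⟩
instance : HNot (IdealQuotient I) := ⟨fun a => ⊤ \ a⟩

theorem mk_sup (a b : L) : mk I (a ⊔ b) = mk I a ⊔ mk I b := rfl
theorem mk_inf (a b : L) : mk I (a ⊓ b) = mk I a ⊓ mk I b := rfl
theorem mk_sdiff (a b : L) : mk I (a \ b) = mk I a \ mk I b := rfl
theorem mk_top : mk I ⊤ = ⊤ := rfl
theorem mk_bot : mk I ⊥ = ⊥ := rfl

theorem mk_mono {a b : L} (h : a ≤ b) : mk I a ≤ mk I b := by
  rw [mk_le_mk, sdiff_eq_bot_iff.2 h]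
  exact I.bot_mem

instance : PartialOrder (IdealQuotient I) where
  le_refl q := by
    obtain ⟨a, rfl⟩ := mk_surjective q
    exact mk_mono le_rfl
  le_trans p q r := by
    obtain ⟨a, rfl⟩ := mk_surjective p
    obtain ⟨b, rfl⟩ := mk_surjective q
    obtain ⟨c, rfl⟩ := mk_surjective r
    exact fun h₁ h₂ => sdiff_mem_trans I h₁ h₂
  le_antisymm p q := by
    obtain ⟨a, rfl⟩ := mk_surjective p
    obtain ⟨b, rfl⟩ := mk_surjective q
    exact fun h₁ h₂ => mk_eq_iff.2 ((symmDiff_mem_iff I).2 ⟨h₁, h₂⟩)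

instance : CoheytingAlgebra (IdealQuotient I) where
  sup := (· ⊔ ·)
  inf := (· ⊓ ·)
  le_sup_left p q := by
    obtain ⟨a, rfl⟩ := mk_surjective p
    obtain ⟨b, rfl⟩ := mk_surjective q
    exact mk_mono le_sup_left
  le_sup_right p q := by
    obtain ⟨a, rfl⟩ := mk_surjective p
    obtain ⟨b, rfl⟩ := mk_surjective q
    exact mk_mono le_sup_right
  sup_le p q r := by
    obtain ⟨a, rfl⟩ := mk_surjective p
    obtain ⟨b, rfl⟩ := mk_surjective q
    obtain ⟨c, rfl⟩ := mk_surjective r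
    rw [← mk_sup, mk_le_mk, mk_le_mk, mk_le_mk, sup_sdiff]
    exact fun h₁ h₂ => Order.Ideal.sup_mem h₁ h₂
  inf_le_left p q := by
    obtain ⟨a, rfl⟩ := mk_surjective p
    obtain ⟨b, rfl⟩ := mk_surjective q
    exact mk_mono inf_le_left
  inf_le_right p q := by
    obtain ⟨a, rfl⟩ := mk_surjective p
    obtain ⟨b, rfl⟩ := mk_surjective q
    exact mk_mono inf_le_right
  le_inf p q r := by
    obtain ⟨a, rfl⟩ := mk_surjective p
    obtain ⟨b, rfl⟩ := mk_surjective q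
    obtain ⟨c, rfl⟩ := mk_surjective r
    rw [← mk_inf, mk_le_mk, mk_le_mk, mk_le_mk, sdiff_inf]
    exact fun h₁ h₂ => Order.Ideal.sup_mem h₁ h₂
  bot_le p := by
    obtain ⟨a, rfl⟩ := mk_surjective p
    exact mk_mono bot_le
  le_top p := by
    obtain ⟨a, rfl⟩ := mk_surjective p
    exact mk_mono le_top
  sdiff_le_iff p q r := by
    obtain ⟨a, rfl⟩ := mk_surjective p
    obtain ⟨b, rfl⟩ := mk_surjective q
    obtain ⟨c, rfl⟩ := mk_surjective r
    change (a \ b) \ c ∈ I ↔ a \ (b ⊔ c) ∈ I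
    rw [sdiff_sdiff]
  top_sdiff _ := rfl

/-- The projection `L/I → L/J` for ideals `I ⊆ J`, induced by the identity of `L`. -/
def factor {I J : Order.Ideal L} (h : I ≤ J) : IdealQuotient I → IdealQuotient J :=
  _root_.Quotient.map id fun _ _ hab => h hab

theorem factor_mk {I J : Order.Ideal L} (h : I ≤ J) (a : L) : factor h (mk I a) = mk J a := rfl

theorem factor_sup {I J : Order.Ideal L} (h : I ≤ J) (p q : IdealQuotient I) :
    factor h (p ⊔ q) = factor h p ⊔ factor h q := by
  obtain ⟨a, rfl⟩ := mk_surjective p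
  obtain ⟨b, rfl⟩ := mk_surjective q
  rfl

theorem factor_inf {I J : Order.Ideal L} (h : I ≤ J) (p q : IdealQuotient I) :
    factor h (p ⊓ q) = factor h p ⊓ factor h q := by
  obtain ⟨a, rfl⟩ := mk_surjective p
  obtain ⟨b, rfl⟩ := mk_surjective q
  rfl

theorem factor_sdiff {I J : Order.Ideal L} (h : I ≤ J) (p q : IdealQuotient I) :
    factor h (p \ q) = factor h p \ factor h q := by
  obtain ⟨a, rfl⟩ := mk_surjective p
  obtain ⟨b, rfl⟩ := mk_surjective q
  rfl

end IdealQuotient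

end Quotient

/-! ### The projective limit of the quotients `L/dL` -/

section Limit

variable (L : Type u) [CoheytingAlgebra L]

/-- The transition map `L/(d+1)L → L/dL`. -/
noncomputable def transition (d : ℕ) :
    IdealQuotient (codimIdeal L (d + 1)) → IdealQuotient (codimIdeal L d) :=
  IdealQuotient.factor (codimIdeal_succ_le d)

/-- The projective limit of the quotients `L/dL`: the compatible sequences. -/
def Completion : Type u :=
  {x : ∀ d : ℕ, IdealQuotient (codimIdeal L d) // ∀ d, transition L d (x (d + 1)) = x d}

namespace Completion

variable {L}

/-- The order and the operations of the projective limit are componentwise. -/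
instance : LE (Completion L) := ⟨fun x y => x.1 ≤ y.1⟩
instance : LT (Completion L) := ⟨fun x y => x.1 < y.1⟩

noncomputable instance : Max (Completion L) := ⟨fun x y => ⟨x.1 ⊔ y.1, fun d => by
  have := IdealQuotient.factor_sup (codimIdeal_succ_le d) (x.1 (d + 1)) (y.1 (d + 1))
  exact this.trans (congrArg₂ (· ⊔ ·) (x.2 d) (y.2 d))⟩⟩

noncomputable instance : Min (Completion L) := ⟨fun x y => ⟨x.1 ⊓ y.1, fun d => by
  have := IdealQuotient.factor_inf (codimIdeal_succ_le d) (x.1 (d + 1)) (y.1 (d + 1))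
  exact this.trans (congrArg₂ (· ⊓ ·) (x.2 d) (y.2 d))⟩⟩

noncomputable instance : SDiff (Completion L) := ⟨fun x y => ⟨x.1 \ y.1, fun d => by
  have := IdealQuotient.factor_sdiff (codimIdeal_succ_le d) (x.1 (d + 1)) (y.1 (d + 1))
  exact this.trans (congrArg₂ (· \ ·) (x.2 d) (y.2 d))⟩⟩

noncomputable instance : Top (Completion L) := ⟨⟨⊤, fun _ => rfl⟩⟩
noncomputable instance : Bot (Completion L) := ⟨⟨⊥, fun _ => rfl⟩⟩
noncomputable instance : HNot (Completion L) := ⟨fun x => ⊤ \ x⟩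

noncomputable instance : CoheytingAlgebra (Completion L) :=
  Function.Injective.coheytingAlgebra (fun x : Completion L => x.1) Subtype.val_injective
    Iff.rfl Iff.rfl (fun _ _ => rfl) (fun _ _ => rfl) rfl rfl
    (fun x => top_sdiff' x.1) (fun _ _ => rfl)

/-- The canonical morphism of co-Heyting algebras from `L` to the projective limit. -/
noncomputable def of : CoheytingHom L (Completion L) where
  toFun a := ⟨fun d => IdealQuotient.mk (codimIdeal L d) a, fun _ => rfl⟩
  map_sup' _ _ := rfl
  map_inf' _ _ := rfl
  map_top' := rfl
  map_sdiff' _ _ := rfl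

end Completion

end Limit

/-! ### The codimetric topology; Hausdorff and precompact algebras -/

section Metric

open scoped symmDiff

open Classical in
/-- `2 ^ (-α)` if `α` is finite, and `0` otherwise. -/
noncomputable def twoPowNeg (α : WithTop Ordinal.{u}) : ℝ :=
  if h : ∃ n : ℕ, α = ((n : Ordinal.{u}) : WithTop Ordinal.{u}) then (1 / 2 : ℝ) ^ h.choose else 0

theorem twoPowNeg_natCast (n : ℕ) :
    twoPowNeg ((n : Ordinal.{u}) : WithTop Ordinal.{u}) = (1 / 2 : ℝ) ^ n := by
  have h : ∃ m : ℕ, ((n : Ordinal.{u}) : WithTop Ordinal.{u}) =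
      ((m : Ordinal.{u}) : WithTop Ordinal.{u}) := ⟨n, rfl⟩
  have e : h.choose = n := (Nat.cast_injective (WithTop.coe_injective h.choose_spec)).symm
  rw [twoPowNeg, dif_pos h, e]

theorem twoPowNeg_nonneg (α : WithTop Ordinal.{u}) : 0 ≤ twoPowNeg α := by
  unfold twoPowNeg
  split_ifs <;> positivity

theorem twoPowNeg_top : twoPowNeg (⊤ : WithTop Ordinal.{u}) = 0 := by
  simp [twoPowNeg]

theorem twoPowNeg_anti : Antitone (twoPowNeg.{u}) := by
  intro α β hαβ
  by_cases h : ∃ n : ℕ, β = ((n : Ordinal.{u}) : WithTop Ordinal.{u})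
  · obtain ⟨n, rfl⟩ := h
    obtain ⟨o, rfl⟩ := WithTop.ne_top_iff_exists.1 (ne_top_of_le_ne_top WithTop.coe_ne_top hαβ)
    have ho : o ≤ (n : Ordinal.{u}) := WithTop.coe_le_coe.1 hαβ
    obtain ⟨m, rfl⟩ := Ordinal.lt_omega0.1 (ho.trans_lt (Ordinal.natCast_lt_omega0 n))
    rw [twoPowNeg_natCast, twoPowNeg_natCast]
    exact pow_le_pow_of_le_one (by norm_num) (by norm_num) (by exact_mod_cast ho)
  · have e : twoPowNeg β = 0 := by rw [twoPowNeg, dif_neg h]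
    rw [e]
    exact twoPowNeg_nonneg α

variable (L : Type u) [CoheytingAlgebra L]

/-- The codimetric pseudometric: `d(a, b) = 2 ^ (-codim (a ∆ b))` if this codimension is finite,
and `0` otherwise. -/
@[reducible]
noncomputable def codimetric : PseudoMetricSpace L where
  dist a b := twoPowNeg (codim (a ∆ b))
  dist_self a := by rw [symmDiff_self, codim_bot, twoPowNeg_top]
  dist_comm a b := by rw [symmDiff_comm]
  dist_triangle a b c := by
    refine (twoPowNeg_anti (codim_anti (symmDiff_triangle a b c))).trans ?_
    rw [codim_sup]
    have h₁ := twoPowNeg_nonneg (codim (a ∆ b))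
    have h₂ := twoPowNeg_nonneg (codim (b ∆ c))
    rcases min_choice (codim (a ∆ b)) (codim (b ∆ c)) with h | h <;> rw [h] <;> linarith

/-- The codimetric topology. -/
@[reducible]
noncomputable def codimetricTopology : TopologicalSpace L :=
  (codimetric L).toUniformSpace.toTopologicalSpace

/-- `L` is Hausdorff: its codimetric topology is Hausdorff. -/
def IsHausdorff : Prop :=
  @T2Space L (codimetricTopology L)

/-- `L` is precompact: every quotient `L/dL` is finite. -/
def IsPrecompact : Prop :=
  ∀ d : ℕ, Finite (IdealQuotient (codimIdeal L d))

end Metric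

/-! ### Completely irreducible elements -/

section Irreducible

variable (E : Type u) [PartialOrder E] [BoundedOrder E]

/-- The completely join irreducible elements: `x ≠ ⊥` such that whenever a subset `A` has a join
which is `≥ x`, some element of `A` is `≥ x`. -/
def completelyJoinIrr : Set E :=
  {x | x ≠ ⊥ ∧ ∀ (A : Set E) (s : E), IsLUB A s → x ≤ s → ∃ a ∈ A, x ≤ a}

/-- The completely meet irreducible elements: `x ≠ ⊤` such that whenever a subset `A` has a meet
which is `≤ x`, some element of `A` is `≤ x`. -/
def completelyMeetIrr : Set E :=
  {x | x ≠ ⊤ ∧ ∀ (A : Set E) (m : E), IsGLB A m → m ≤ x → ∃ a ∈ A, a ≤ x}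

end Irreducible

end CoHeyting

namespace CoHeyting

/-! ### Finite values of the foundation rank -/

section FiniteRank

variable {E : Type u} [Preorder E]

/-! Everything is read off the prime filters of finite height. By the prime ideal theorem, `a \ b`
lies in `dL` iff every prime filter of height less than `d` containing `a` contains `b`
(`sdiff_mem_codimIdeal_iff`). Precompactness therefore leaves only finitely many prime filters of
each finite height, and the Hausdorff property says that those of finite height determine the order
of `L`.

Each prime filter `p` of finite height is then principal with principal complement: it has a least
element `j p`, and there is a largest element `b p` outside it (`exists_ge_iff_mem`,
`exists_le_iff_not_mem`). So `y ≤ b p` iff not `j p ≤ y`. Pure order theory on such splitting pairs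
identifies the `b p` with the completely meet irreducible elements and the `j p` with the completely
join irreducible ones, and gives the bijection and the meet representation. The images of these
pairs still split the completion and determine its order, so nothing new appears there.

Finally `p ↦ b p` reverses inclusion, so the cofoundation rank of `b p` is the height of `p`. It is
finite, which forces the ascending chain condition. -/

theorem natCast_succ_le_foundationRank_iff (n : ℕ) (x : E) :
    (((n + 1 : ℕ) : Ordinal.{u}) : WithTop Ordinal.{u}) ≤ foundationRank x ↔
      ∃ y < x, ((n : Ordinal.{u}) : WithTop Ordinal.{u}) ≤ foundationRank y := by
  rw [le_foundationRank_iff]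
  constructor
  · intro h
    exact h n (by exact_mod_cast Nat.lt_succ_self n)
  · rintro ⟨y, hy, hn⟩ β hβ
    refine ⟨y, hy, le_trans (WithTop.coe_le_coe.2 ?_) hn⟩
    rwa [Nat.cast_succ, Order.lt_add_one_iff] at hβ

theorem natCast_zero_le (α : WithTop Ordinal.{u}) :
    (((0 : ℕ) : Ordinal.{u}) : WithTop Ordinal.{u}) ≤ α := by
  cases α with
  | top => exact le_top
  | coe a => exact WithTop.coe_le_coe.2 (by simp)

theorem exists_eq_natCast_of_not_le {α : WithTop Ordinal.{u}} {n : ℕ}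
    (h : ¬ ((n : Ordinal.{u}) : WithTop Ordinal.{u}) ≤ α) :
    ∃ m : ℕ, α = ((m : Ordinal.{u}) : WithTop Ordinal.{u}) := by
  obtain ⟨o, rfl⟩ := WithTop.ne_top_iff_exists.1 (not_le.1 h).ne_top
  have ho : o < (n : Ordinal.{u}) := WithTop.coe_lt_coe.1 (not_le.1 h)
  obtain ⟨m, rfl⟩ := Ordinal.lt_omega0.1 (ho.trans (Ordinal.natCast_lt_omega0 n))
  exact ⟨m, rfl⟩

end FiniteRank

/-! ### Prime filters of bounded height -/

section Spectrum

variable {L : Type u} [Lattice L]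

/-- The prime filters of height less than `d`. -/
def specBelow (L : Type u) [Lattice L] (d : ℕ) : Set (Spec L) :=
  {p | ¬ ((d : Ordinal.{u}) : WithTop Ordinal.{u}) ≤ height p}

theorem not_mem_specBelow_zero (p : Spec L) : p ∉ specBelow L 0 :=
  fun h => h (natCast_zero_le _)

theorem mem_specBelow_succ {d : ℕ} {p : Spec L} :
    p ∈ specBelow L (d + 1) ↔ ∀ q < p, q ∈ specBelow L d := by
  unfold specBelow height
  rw [Set.mem_ofPred_eq, natCast_succ_le_foundationRank_iff]
  simp

theorem specBelow_mono : Monotone (specBelow L) := by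
  intro d e h p hp hle
  exact hp (le_trans (WithTop.coe_le_coe.2 (by exact_mod_cast h)) hle)

theorem specBelow_of_le {d : ℕ} {p q : Spec L} (hp : p ∈ specBelow L d) (h : q ≤ p) :
    q ∈ specBelow L d := by
  rcases h.eq_or_lt with rfl | h
  · exact hp
  cases d with
  | zero => exact absurd hp (not_mem_specBelow_zero p)
  | succ d => exact specBelow_mono (Nat.le_succ d) (mem_specBelow_succ.1 hp q h)

/-- Descending from a prime filter of finite height meets every smaller height; `q` has height
exactly `d`. The bound `e` only drives the induction. -/
theorem exists_le_mem_specBelow_diff {d : ℕ} (e : ℕ) {p : Spec L} (hp : p ∈ specBelow L e)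
    (hd : p ∉ specBelow L d) : ∃ q ≤ p, q ∈ specBelow L (d + 1) ∧ q ∉ specBelow L d := by
  induction e generalizing p with
  | zero => exact absurd hp (not_mem_specBelow_zero p)
  | succ e ih =>
    by_cases h : p ∈ specBelow L (d + 1)
    · exact ⟨p, le_rfl, h, hd⟩
    · rw [mem_specBelow_succ] at h
      push Not at h
      obtain ⟨q, hqp, hq⟩ := h
      obtain ⟨r, hr, h⟩ := ih (mem_specBelow_succ.1 hp q hqp) hq
      exact ⟨r, hr.trans hqp.le, h⟩

theorem mem_or_mem_of_sup_mem {p : Spec L} {a b : L} (h : a ⊔ b ∈ p.1) : a ∈ p.1 ∨ b ∈ p.1 := by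
  by_contra! hcon
  obtain ⟨c, hc, hac, hbc⟩ := p.2.compl_ideal.Directed a hcon.1 b hcon.2
  exact hc (Order.PFilter.mem_of_le (sup_le hac hbc) h)

/-- Over a finite set of prime filters, every upper set is cut out by an element. -/
theorem exists_mem_iff_of_finite [BoundedOrder L] {S : Set (Spec L)} (hS : S.Finite)
    (U : Set (Spec L)) (hU : IsUpperSet U) :
    ∃ a : L, ∀ q ∈ S, a ∈ q.1 ↔ q ∈ U := by
  classical
  -- An element that cuts out the cone above `p` within `S`: the meet of finitely many witnesses,
  -- one against each `q ∈ S` not containing `p`. The join of these elements over `S ∩ U` then cuts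
  -- out `U`.
  have h₁ : ∀ p : Spec L, ∃ a ∈ p.1, ∀ q ∈ S, a ∈ q.1 → p ≤ q := by
    intro p
    have hT : (S ∩ {q | ¬ p ≤ q}).Finite := hS.inter_of_left _
    have h₂ : ∀ q : Spec L, ∃ c ∈ p.1, ¬ p ≤ q → c ∉ q.1 := by
      intro q
      by_cases hpq : p ≤ q
      · exact ⟨⊤, p.1.top_mem, fun h => absurd hpq h⟩
      · obtain ⟨c, hc, hcq⟩ := Set.not_subset.1 (show ¬ (p.1 : Set L) ⊆ q.1 from hpq)
        exact ⟨c, hc, fun _ => hcq⟩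
    choose c hcp hcq using h₂
    refine ⟨hT.toFinset.inf c, ?_, fun q hq ha => ?_⟩
    · exact Finset.inf_induction p.1.top_mem
        (fun _ h _ h' => Order.PFilter.inf_mem h h') (fun q _ => hcp q)
    · by_contra hpq
      exact hcq q hpq (Order.PFilter.mem_of_le
        (Finset.inf_le (hT.mem_toFinset.2 ⟨hq, hpq⟩)) ha)
  choose a hap haq using h₁
  have hT : (S ∩ U).Finite := hS.inter_of_left _
  refine ⟨hT.toFinset.sup a, fun q hq => ⟨fun h => ?_, fun h => ?_⟩⟩
  -- Primeness extended to finite joins; the empty join is excluded because `q` is proper.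
  · have key : ∀ s : Finset (Spec L), s.sup a ∈ q.1 → ∃ p ∈ s, a p ∈ q.1 := by
      intro s
      induction s using Finset.induction_on with
      | empty =>
        intro h
        obtain ⟨c, hc⟩ := q.2.compl_ideal.Nonempty
        exact absurd (Order.PFilter.mem_of_le (by simp) h) hc
      | insert p s _ ih =>
        rw [Finset.sup_insert]
        intro h
        rcases mem_or_mem_of_sup_mem h with h | h
        · exact ⟨p, by simp, h⟩
        · obtain ⟨r, hr, h⟩ := ih h
          exact ⟨r, by simp [hr], h⟩
    obtain ⟨p, hp, h⟩ := key _ h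
    exact hU (haq p q hq h) (hT.mem_toFinset.1 hp).2
  · exact Order.PFilter.mem_of_le (Finset.le_sup (hT.mem_toFinset.2 ⟨hq, h⟩)) (hap q)

end Spectrum

/-! ### Finite heights, the quotients `L/dL`, and generators of prime filters -/

section CoHeytingSpectrum

variable {L : Type u} [CoheytingAlgebra L]

open scoped symmDiff

/-- The ideal generated by `b` and the complement of `p` misses the filter above `a`: if `a ≤ c ⊔ b`
with `c ∉ p`, then `a \ b ≤ c` would put `c` in `p`. A prime ideal separating the two has the
required `q` as complement. -/
theorem exists_le_of_sdiff_mem {p : Spec L} {a b : L} (h : a \ b ∈ p.1) :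
    ∃ q ≤ p, a ∈ q.1 ∧ b ∉ q.1 := by
  let I : Order.Ideal L := p.2.compl_ideal.toIdeal ⊔ Order.Ideal.principal b
  have hI : ∀ y, y ∈ I ↔ ∃ c, c ∉ p.1 ∧ y ≤ c ⊔ b := by
    intro y
    rw [Order.Ideal.mem_sup]
    constructor
    · rintro ⟨c, hc, d, hd, hy⟩
      exact ⟨c, hc, hy.trans (sup_le_sup_left hd c)⟩
    · rintro ⟨c, hc, hy⟩
      exact ⟨c, hc, b, le_rfl, hy⟩
  have hdisj : Disjoint (Order.PFilter.principal a : Set L) (I : Set L) := by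
    rw [Set.disjoint_left]
    intro y hay hy
    obtain ⟨c, hc, hyc⟩ := (hI y).1 hy
    have hay : a ≤ y := hay
    refine hc (Order.PFilter.mem_of_le ?_ h)
    rw [sdiff_le_iff, sup_comm]
    exact hay.trans hyc
  obtain ⟨J, hJ, hIJ, hFJ⟩ := DistribLattice.prime_ideal_of_disjoint_filter_ideal hdisj
  have hmem : ∀ y, y ∈ hJ.compl_filter.toPFilter ↔ y ∉ J := fun _ => Iff.rfl
  refine ⟨⟨hJ.compl_filter.toPFilter, ⟨?_⟩⟩, ?_, ?_, ?_⟩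
  · have e : ((hJ.compl_filter.toPFilter : Order.PFilter L) : Set L)ᶜ = (J : Set L) := by
      ext y
      simp [hmem]
    rw [e]
    exact J.isIdeal
  · intro y hy
    by_contra hyp
    exact hy (hIJ ((hI y).2 ⟨y, hyp, le_sup_left⟩))
  · exact Set.disjoint_left.1 hFJ (show a ≤ a from le_rfl)
  · intro hb
    obtain ⟨c, hc⟩ := p.2.compl_ideal.Nonempty
    exact hb (hIJ ((hI b).2 ⟨c, hc, le_sup_right⟩))

theorem sdiff_mem_codimIdeal_iff {d : ℕ} {a b : L} :
    a \ b ∈ codimIdeal L d ↔ ∀ p ∈ specBelow L d, a ∈ p.1 → b ∈ p.1 := by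
  constructor
  · intro h p hp ha
    rcases mem_or_mem_of_sup_mem (Order.PFilter.mem_of_le (le_sup_sdiff (a := b)) ha) with hb | hb
    · exact hb
    · exact absurd ((mem_codimIdeal.1 h).trans (codim_le_height p hb)) hp
  · intro h
    refine mem_codimIdeal.2 (le_codim fun p hp => ?_)
    by_contra hd
    obtain ⟨q, hqp, ha, hb⟩ := exists_le_of_sdiff_mem hp
    exact hb (h q (specBelow_of_le hd hqp) ha)

theorem mk_le_mk_iff_specBelow {d : ℕ} {a b : L} :
    IdealQuotient.mk (codimIdeal L d) a ≤ IdealQuotient.mk (codimIdeal L d) b ↔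
      ∀ p ∈ specBelow L d, a ∈ p.1 → b ∈ p.1 :=
  IdealQuotient.mk_le_mk.trans sdiff_mem_codimIdeal_iff

/-- A prime filter of height less than `d` is determined by its image in `L/dL`, and a finite set
has finitely many subsets. -/
theorem IsPrecompact.finite_specBelow (hP : IsPrecompact L) (d : ℕ) : (specBelow L d).Finite := by
  have := hP d
  refine Set.Finite.of_injOn
    (f := fun p : Spec L => IdealQuotient.mk (codimIdeal L d) '' (p.1 : Set L))
    (t := Set.univ) (fun _ _ => Set.mem_univ _) ?_ Set.finite_univ
  have key : ∀ p ∈ specBelow L d, ∀ q ∈ specBelow L d,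
      IdealQuotient.mk (codimIdeal L d) '' (p.1 : Set L) =
        IdealQuotient.mk (codimIdeal L d) '' (q.1 : Set L) → p ≤ q := by
    intro p _ q hq h a ha
    obtain ⟨b, hb, hab⟩ := h.subset (Set.mem_image_of_mem _ ha)
    exact mk_le_mk_iff_specBelow.1 hab.le q hq hb
  intro p hp q hq h
  exact le_antisymm (key p hp q hq h) (key q hq p hp h.symm)

theorem IsHausdorff.le_of_forall (hH : IsHausdorff L) {a b : L}
    (h : ∀ d, ∀ p ∈ specBelow L d, a ∈ p.1 → b ∈ p.1) : a ≤ b := by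
  have hcodim : ∀ d : ℕ, ((d : Ordinal.{u}) : WithTop Ordinal.{u}) ≤ codim (a \ b) :=
    fun d => mem_codimIdeal.1 (sdiff_mem_codimIdeal_iff.2 (h d))
  let _ := codimetric L
  have : T2Space L := hH
  have hdist : dist (a \ b) ⊥ = 0 := by
    change twoPowNeg (codim ((a \ b) ∆ ⊥)) = 0
    -- The codimension of `a \ b` exceeds every natural number, so the distance takes its default
    -- value `0`.
    rw [symmDiff_bot, twoPowNeg, dif_neg]
    rintro ⟨n, hn⟩
    have := hcodim (n + 1)
    rw [hn, WithTop.coe_le_coe, Nat.cast_le] at this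
    omega
  exact sdiff_eq_bot_iff.1 (Metric.inseparable_iff.2 hdist).eq

theorem exists_le_iff_not_mem (hH : IsHausdorff L) (hP : IsPrecompact L) {d : ℕ} {p : Spec L}
    (hp : p ∈ specBelow L d) : ∃ b : L, ∀ y, y ≤ b ↔ y ∉ p.1 := by
  -- The bound is `d + 1` so that `b` is also controlled at height exactly `d`. A prime filter of
  -- larger finite height contains one of height `d`, which cannot lie below `p` and so contains
  -- `b`.
  obtain ⟨b, hb⟩ := exists_mem_iff_of_finite (hP.finite_specBelow (d + 1)) {q | ¬ q ≤ p}
    (fun q r hqr hq hr => hq (hqr.trans hr))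
  have hbp : b ∉ p.1 := fun h =>
    (hb p (specBelow_mono (Nat.le_succ d) hp)).1 h le_rfl
  refine ⟨b, fun y => ⟨fun hy h => hbp (Order.PFilter.mem_of_le hy h), fun hy => ?_⟩⟩
  refine hH.le_of_forall fun e q hq hyq => ?_
  by_cases hqd : q ∈ specBelow L d
  · exact (hb q (specBelow_mono (Nat.le_succ d) hqd)).2 fun h => hy (h hyq)
  · obtain ⟨r, hrq, hr, hrd⟩ := exists_le_mem_specBelow_diff e hq hqd
    exact hrq ((hb r hr).2 fun h => hrd (specBelow_of_le hp h))

theorem exists_ge_iff_mem (hH : IsHausdorff L) (hP : IsPrecompact L) {d : ℕ} {p : Spec L}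
    (hp : p ∈ specBelow L d) : ∃ j : L, ∀ y, j ≤ y ↔ y ∈ p.1 := by
  obtain ⟨b, hb⟩ := exists_le_iff_not_mem hH hP hp
  obtain ⟨a, ha⟩ := exists_mem_iff_of_finite (hP.finite_specBelow d) (Set.Ici p) (isUpperSet_Ici p)
  have hbp : b ∉ p.1 := (hb b).1 le_rfl
  have hj : a \ b ∈ p.1 := by
    have hap : a ∈ p.1 := (ha p hp).2 (Set.mem_Ici.2 le_rfl)
    exact (mem_or_mem_of_sup_mem
      (Order.PFilter.mem_of_le (le_sup_sdiff (a := b)) hap)).resolve_left hbp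
  -- Here `a` selects the prime filters above `p` among those of height less than `d`, and `b`
  -- belongs to every prime filter not below `p`. Subtracting `b` thus removes the uncontrolled part
  -- of `a`.
  refine ⟨a \ b, fun y => ⟨fun h => Order.PFilter.mem_of_le h hj, fun hy => ?_⟩⟩
  rw [sdiff_le_iff]
  refine hH.le_of_forall fun e q hq haq => ?_
  by_cases hqp : q ≤ p
  · have hpq : p ≤ q := (ha q (specBelow_of_le hp hqp)).1 haq
    exact Order.PFilter.mem_of_le le_sup_right (hpq hy)
  · obtain ⟨c, hcq, hcp⟩ := Set.not_subset.1 (show ¬ (q.1 : Set L) ⊆ p.1 from hqp)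
    exact Order.PFilter.mem_of_le (((hb c).2 hcp).trans le_sup_left) hcq

/-- The prime filters of finite height. -/
abbrev FiniteSpec (L : Type u) [Lattice L] : Type u :=
  {p : Spec L // ∃ d, p ∈ specBelow L d}

end CoHeytingSpectrum

/-! ### Order theory of splitting pairs -/

section SplittingPairs

variable {E : Type*} [PartialOrder E] {P : Type*} {j b : P → E}

theorem isGLB_of_splitting (h : ∀ p y, y ≤ b p ↔ ¬ j p ≤ y)
    (hs : ∀ x y, (∀ p, j p ≤ x → j p ≤ y) → x ≤ y) (x : E) :
    IsGLB (Set.range b ∩ Set.Ici x) x := by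
  refine ⟨fun y hy => hy.2, fun c hc => hs c x fun p hpc => ?_⟩
  by_contra hpx
  exact (h p c).1 (hc ⟨⟨p, rfl⟩, (h p x).2 hpx⟩) hpc

theorem isLUB_of_splitting (hs : ∀ x y, (∀ p, j p ≤ x → j p ≤ y) → x ≤ y) (x : E) :
    IsLUB (Set.range j ∩ Set.Iic x) x :=
  ⟨fun _ hy => hy.2, fun c hc => hs x c fun p hpx => hc ⟨⟨p, rfl⟩, hpx⟩⟩

end SplittingPairs

section SplittingPairsIrr

variable {E : Type u} [PartialOrder E] [BoundedOrder E] {P : Type*} {j b : P → E}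

/-- A completely meet irreducible `x` is the meet of the `b p` above it, hence equals one of them.
Conversely, if no member of `A` is below `b p`, then `j p` is a lower bound of `A`, hence below its
meet, which is then not below `b p`. -/
theorem completelyMeetIrr_eq_range (h : ∀ p y, y ≤ b p ↔ ¬ j p ≤ y)
    (hs : ∀ x y, (∀ p, j p ≤ x → j p ≤ y) → x ≤ y) :
    completelyMeetIrr E = Set.range b := by
  ext x
  constructor
  · rintro ⟨-, hx⟩
    obtain ⟨a, ⟨⟨p, rfl⟩, hxa⟩, hax⟩ := hx _ _ (isGLB_of_splitting h hs x) le_rfl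
    exact ⟨p, le_antisymm hax hxa⟩
  · rintro ⟨p, rfl⟩
    refine ⟨fun htop => (h p (b p)).1 le_rfl (htop ▸ le_top), fun A m hm hmb => ?_⟩
    by_contra! hA
    exact (h p m).1 hmb (hm.2 fun a ha => not_not.1 fun hpa => hA a ha ((h p a).2 hpa))

theorem completelyJoinIrr_eq_range (h : ∀ p y, y ≤ b p ↔ ¬ j p ≤ y)
    (hs : ∀ x y, (∀ p, j p ≤ x → j p ≤ y) → x ≤ y) :
    completelyJoinIrr E = Set.range j := by
  ext x
  constructor
  · rintro ⟨-, hx⟩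
    obtain ⟨a, ⟨⟨p, rfl⟩, hax⟩, hxa⟩ := hx _ _ (isLUB_of_splitting hs x) le_rfl
    exact ⟨p, le_antisymm hax hxa⟩
  · rintro ⟨p, rfl⟩
    refine ⟨fun hbot => (h p (b p)).1 le_rfl (hbot ▸ bot_le), fun A s hA hps => ?_⟩
    by_contra! hcon
    exact (h p s).1 (hA.2 fun a ha => (h p a).2 (hcon a ha)) hps

theorem exists_orderIso_of_splitting (h : ∀ p y, y ≤ b p ↔ ¬ j p ≤ y)
    (hs : ∀ x y, (∀ p, j p ≤ x → j p ≤ y) → x ≤ y) :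
    ∃ e : completelyJoinIrr E ≃o completelyMeetIrr E,
      (∀ x : completelyJoinIrr E, IsLUB {y : E | ¬ (x : E) ≤ y} (e x : E)) ∧
      (∀ x : completelyMeetIrr E, IsGLB {y : E | ¬ y ≤ (x : E)} (e.symm x : E)) := by
  have hle : ∀ p q, b p ≤ b q ↔ j p ≤ j q := fun p q =>
    (h q (b p)).trans (by rw [← not_iff_not, ← h p (j q), not_not])
  rw [completelyJoinIrr_eq_range h hs, completelyMeetIrr_eq_range h hs]
  -- The choice of index is harmless: by `hle`, equal `j p` have equal `b p`.
  have hc : ∀ x : Set.range j, ∃ p, j p = x := fun x => x.2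
  choose c hc using hc
  let f : Set.range j ↪o Set.range b :=
    OrderEmbedding.ofMapLEIff (fun x => ⟨b (c x), Set.mem_range_self _⟩) fun x y => by
      rw [← Subtype.coe_le_coe, ← Subtype.coe_le_coe, hle, hc, hc]
  have hf : Function.Surjective f := by
    rintro ⟨_, p, rfl⟩
    refine ⟨⟨j p, p, rfl⟩, Subtype.ext (le_antisymm ?_ ?_)⟩
    · exact (hle _ _).2 (hc ⟨j p, p, rfl⟩).le
    · exact (hle _ _).2 (hc ⟨j p, p, rfl⟩).ge
  let e : Set.range j ≃o Set.range b := RelIso.ofSurjective f hf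
  have he : ∀ x, (e x : E) = b (c x) := fun _ => rfl
  refine ⟨e, fun x => ?_, fun x => ?_⟩
  · rw [he, ← hc x, show {y | ¬ j (c x) ≤ y} = Set.Iic (b (c x)) from
      Set.ext fun y => (h (c x) y).symm]
    exact isLUB_Iic
  · obtain ⟨y, rfl⟩ := e.surjective x
    rw [e.symm_apply_apply, he, ← hc y, show {z | ¬ z ≤ b (c y)} = Set.Ici (j (c y)) from
      Set.ext fun z => by rw [Set.mem_ofPred_eq, h, not_not, Set.mem_Ici]]
    exact isGLB_Ici

end SplittingPairsIrr

/-! ### Prime filters of finite height acting on the completion -/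

section CompletionMembership

variable {L : Type u} [CoheytingAlgebra L]

theorem Completion.mk_eq_of_le {y : Completion L} {d e : ℕ} (hde : d ≤ e) {a : L}
    (ha : IdealQuotient.mk (codimIdeal L e) a = y.1 e) :
    IdealQuotient.mk (codimIdeal L d) a = y.1 d := by
  induction e, hde using Nat.le_induction with
  | base => exact ha
  | succ e _ ih =>
    refine ih ?_
    rw [← y.2 e, ← ha]
    rfl

/-- The prime filter `p` of finite height contains the components of `y`. -/
def Completion.Mem (p : Spec L) (y : Completion L) : Prop :=
  ∃ d, p ∈ specBelow L d ∧ ∃ a ∈ p.1, IdealQuotient.mk (codimIdeal L d) a = y.1 d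

/-- Membership depends neither on the level `d` nor on the representative, since two levels can be
compared at the lower one. -/
theorem Completion.mem_iff {p : Spec L} {y : Completion L} {d : ℕ} (hp : p ∈ specBelow L d)
    {a : L} (ha : IdealQuotient.mk (codimIdeal L d) a = y.1 d) : Completion.Mem p y ↔ a ∈ p.1 := by
  refine ⟨?_, fun h => ⟨d, hp, a, h, ha⟩⟩
  rintro ⟨e, hpe, c, hc, hce⟩
  rcases le_total d e with h | h
  · exact mk_le_mk_iff_specBelow.1 ((mk_eq_of_le h hce).trans ha.symm).le p hp hc
  · exact mk_le_mk_iff_specBelow.1 (hce.trans (mk_eq_of_le h ha).symm).le p hpe hc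

theorem Completion.le_iff {x y : Completion L} :
    x ≤ y ↔ ∀ d, ∀ p ∈ specBelow L d, Completion.Mem p x → Completion.Mem p y := by
  change (∀ d, x.1 d ≤ y.1 d) ↔ _
  refine forall_congr' fun d => ?_
  obtain ⟨a, ha⟩ := IdealQuotient.mk_surjective (x.1 d)
  obtain ⟨c, hc⟩ := IdealQuotient.mk_surjective (y.1 d)
  rw [← ha, ← hc, mk_le_mk_iff_specBelow]
  refine forall₂_congr fun p hp => ?_
  rw [mem_iff hp ha, mem_iff hp hc]

theorem Completion.mem_of_iff {p : Spec L} {d : ℕ} (hp : p ∈ specBelow L d) (a : L) :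
    Completion.Mem p (Completion.of a) ↔ a ∈ p.1 :=
  mem_iff hp rfl

theorem Completion.Mem.mono {p q : Spec L} {d : ℕ} (hq : q ∈ specBelow L d) (hpq : p ≤ q)
    {y : Completion L} (h : Completion.Mem p y) : Completion.Mem q y := by
  obtain ⟨a, ha⟩ := IdealQuotient.mk_surjective (y.1 d)
  rw [mem_iff (specBelow_of_le hq hpq) ha] at h
  exact (mem_iff hq ha).2 (hpq h)

theorem Completion.of_injective (hH : IsHausdorff L) :
    Function.Injective (Completion.of : CoheytingHom L (Completion L)) := by
  have key : ∀ a c : L, (Completion.of a : Completion L) ≤ Completion.of c → a ≤ c :=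
    fun a c h => hH.le_of_forall fun d p hp ha =>
      (mem_of_iff hp c).1 (le_iff.1 h d p hp ((mem_of_iff hp a).2 ha))
  exact fun a c h => le_antisymm (key a c h.le) (key c a h.ge)

/-- With `Completion.le_of_iff_not_mem`, this carries the splitting pair of `p` over to the
completion: `j ∈ q` means `p ≤ q`, and `b ∉ q` means `q ≤ p`. -/
theorem Completion.of_le_iff_mem {p : Spec L} {d : ℕ} (hp : p ∈ specBelow L d) {j : L}
    (hj : ∀ y, j ≤ y ↔ y ∈ p.1) (y : Completion L) : Completion.of j ≤ y ↔ Completion.Mem p y := by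
  rw [le_iff]
  constructor
  · exact fun h => h d p hp ((mem_of_iff hp j).2 ((hj j).1 le_rfl))
  · intro h e q hq hjq
    rw [mem_of_iff hq] at hjq
    exact h.mono hq fun y hy => Order.PFilter.mem_of_le ((hj y).2 hy) hjq

theorem Completion.le_of_iff_not_mem {p : Spec L} {d : ℕ} (hp : p ∈ specBelow L d) {b : L}
    (hb : ∀ y, y ≤ b ↔ y ∉ p.1) (y : Completion L) :
    y ≤ Completion.of b ↔ ¬ Completion.Mem p y := by
  rw [le_iff]
  constructor
  · exact fun h hy => (hb b).1 le_rfl ((mem_of_iff hp b).1 (h d p hp hy))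
  · intro h e q hq hyq
    rw [mem_of_iff hq]
    by_contra hbq
    refine h (hyq.mono hp fun c hc => ?_)
    by_contra hcp
    exact hbq (Order.PFilter.mem_of_le ((hb c).2 hcp) hc)

end CompletionMembership

/-! ### Cofoundation rank as height -/

section CofoundationRank

variable {L : Type u} [CoheytingAlgebra L]

/-- The map `b` reverses inclusion and the prime filters of finite height form a lower set of the
spectrum, so both ranks obey the same recursion. -/
theorem natCast_le_cofoundationRank_iff {b : FiniteSpec L → L}
    (hb : ∀ p y, y ≤ b p ↔ y ∉ p.1.1) (hM : completelyMeetIrr L = Set.range b) (n : ℕ) :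
    ∀ (p : FiniteSpec L) (x : completelyMeetIrr L), (x : L) = b p →
      (((n : Ordinal.{u}) : WithTop Ordinal.{u}) ≤ cofoundationRank x ↔
        p.1 ∉ specBelow L n) := by
  have hle : ∀ p q, b p ≤ b q ↔ q ≤ p := by
    intro p q
    rw [hb]
    constructor
    · intro h y hy
      by_contra hyp
      exact h (Order.PFilter.mem_of_le ((hb p y).2 hyp) hy)
    · exact fun h hq => (hb p (b p)).1 le_rfl (h hq)
  have hlt : ∀ p q, b p < b q ↔ q < p := fun p q => by
    rw [lt_iff_le_not_ge, lt_iff_le_not_ge, hle, hle]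
  induction n with
  | zero =>
    intro p x _
    exact iff_of_true (natCast_zero_le _) (not_mem_specBelow_zero _)
  | succ n ih =>
    intro p x hx
    rw [cofoundationRank, natCast_succ_le_foundationRank_iff, mem_specBelow_succ]
    push Not
    constructor
    · rintro ⟨y, hyx, hn⟩
      have hyx : (x : L) < (OrderDual.ofDual y : completelyMeetIrr L) := hyx
      obtain ⟨q, hq⟩ := hM.subset (OrderDual.ofDual y).2
      rw [hx, ← hq, hlt] at hyx
      exact ⟨q.1, hyx, (ih q (OrderDual.ofDual y) hq.symm).1 hn⟩
    · rintro ⟨q, hqp, hn⟩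
      let q' : FiniteSpec L := ⟨q, p.2.imp fun _ hd => specBelow_of_le hd hqp.le⟩
      let y : completelyMeetIrr L := ⟨b q', hM.superset ⟨q', rfl⟩⟩
      refine ⟨OrderDual.toDual y, ?_, (ih q' y rfl).2 hn⟩
      have : (x : L) < (y : L) := by
        rw [hx]
        exact (hlt p q').2 hqp
      exact this

theorem wellFoundedGT_of_cofoundationRank {E : Type u} [Preorder E]
    (h : ∀ x : E, ∃ n : ℕ, cofoundationRank x = ((n : Ordinal.{u}) : WithTop Ordinal.{u})) :
    WellFoundedGT E := by
  refine ⟨⟨fun x => ?_⟩⟩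
  by_contra hacc
  obtain ⟨n, hn⟩ := h x
  -- Outside the well-founded part the rank is `⊤` by definition, which is not a natural number.
  rw [cofoundationRank, foundationRank, dif_neg (show
    ¬ Acc (fun a b : Eᵒᵈ => a < b) (OrderDual.toDual x) from hacc)] at hn
  exact WithTop.top_ne_coe hn

end CofoundationRank

end CoHeyting

/-! ### The proposition -/

theorem mainTheorem7 (L : Type u) [CoheytingAlgebra L]
    (hH : CoHeyting.IsHausdorff L) (hP : CoHeyting.IsPrecompact L) :
    -- `L` embeds in its completion, with the same completely meet irreducible elements
    (Function.Injective (CoHeyting.Completion.of : CoheytingHom L (CoHeyting.Completion L)) ∧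
      (CoHeyting.Completion.of : CoheytingHom L (CoHeyting.Completion L)) ''
          CoHeyting.completelyMeetIrr L
        = CoHeyting.completelyMeetIrr (CoHeyting.Completion L)) ∧
    -- `x ↦ x^∧` and `x ↦ x^∨` exist and are mutually inverse order isomorphisms
    (∃ e : CoHeyting.completelyJoinIrr L ≃o CoHeyting.completelyMeetIrr L,
      (∀ x : CoHeyting.completelyJoinIrr L, IsLUB {y : L | ¬ (x : L) ≤ y} (e x : L)) ∧
      (∀ x : CoHeyting.completelyMeetIrr L, IsGLB {y : L | ¬ y ≤ (x : L)} (e.symm x : L))) ∧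
    -- finite cofoundation rank
    (∀ x : CoHeyting.completelyMeetIrr L, ∃ n : ℕ,
      CoHeyting.cofoundationRank x = ((n : Ordinal.{u}) : WithTop Ordinal.{u})) ∧
    -- ascending chain condition
    WellFoundedGT (CoHeyting.completelyMeetIrr L) ∧
    -- every element is the meet of the completely meet irreducible elements above it
    (∀ a : L, IsGLB (CoHeyting.completelyMeetIrr L ∩ Set.Ici a) a) := by
  have hj : ∀ p : CoHeyting.FiniteSpec L, ∃ j : L, ∀ y, j ≤ y ↔ y ∈ p.1.1 := fun p =>
    CoHeyting.exists_ge_iff_mem hH hP p.2.choose_spec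
  have hb : ∀ p : CoHeyting.FiniteSpec L, ∃ b : L, ∀ y, y ≤ b ↔ y ∉ p.1.1 := fun p =>
    CoHeyting.exists_le_iff_not_mem hH hP p.2.choose_spec
  choose j hj using hj
  choose b hb using hb
  have h : ∀ p y, y ≤ b p ↔ ¬ j p ≤ y := fun p y => by rw [hb, hj]
  have hs : ∀ x y, (∀ p, j p ≤ x → j p ≤ y) → x ≤ y := fun x y hxy =>
    hH.le_of_forall fun d p hp hx => (hj ⟨p, d, hp⟩ y).1 (hxy _ ((hj ⟨p, d, hp⟩ x).2 hx))
  have hjc := fun (p : CoHeyting.FiniteSpec L) =>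
    CoHeyting.Completion.of_le_iff_mem p.2.choose_spec (hj p)
  have hbc := fun (p : CoHeyting.FiniteSpec L) =>
    CoHeyting.Completion.le_of_iff_not_mem p.2.choose_spec (hb p)
  have hM := CoHeyting.completelyMeetIrr_eq_range h hs
  have hMc : CoHeyting.completelyMeetIrr (CoHeyting.Completion L) =
      Set.range fun p => (CoHeyting.Completion.of (b p) : CoHeyting.Completion L) := by
    -- The same characterization, applied in the completion to the images of the pairs from `L`.
    refine CoHeyting.completelyMeetIrr_eq_range
      (j := fun p => (CoHeyting.Completion.of (j p) : CoHeyting.Completion L))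
      (fun p y => by rw [hbc, hjc]) fun x y hxy => ?_
    rw [CoHeyting.Completion.le_iff]
    exact fun d p hp hx =>
      (hjc ⟨p, d, hp⟩ y).1 (hxy ⟨p, d, hp⟩ ((hjc ⟨p, d, hp⟩ x).2 hx))
  have hrank : ∀ x : CoHeyting.completelyMeetIrr L, ∃ n : ℕ,
      CoHeyting.cofoundationRank x = ((n : Ordinal.{u}) : WithTop Ordinal.{u}) := by
    intro x
    obtain ⟨p, hp⟩ := hM.subset x.2
    obtain ⟨d, hd⟩ := p.2
    refine CoHeyting.exists_eq_natCast_of_not_le (n := d) fun hle => ?_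
    exact (CoHeyting.natCast_le_cofoundationRank_iff hb hM d p x hp.symm).1 hle hd
  refine ⟨⟨CoHeyting.Completion.of_injective hH, ?_⟩,
    CoHeyting.exists_orderIso_of_splitting h hs, hrank,
    CoHeyting.wellFoundedGT_of_cofoundationRank hrank, fun a => ?_⟩
  · rw [hM, hMc, ← Set.range_comp]
    rfl
  · rw [hM]
    exact CoHeyting.isGLB_of_splitting h hs a
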